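/- Let $n\ge 1$ and $d\ge 1$ be integers, let $\mathbb{N}=\{0,1,2,\dots\}$, and write $\mathbb{R}[\underline{X}]=\mathbb{R}[X_1,\dots,X_n]$ and $\underline{x}^s=x_1^{s_1}\cdots x_n^{s_n}$ for $\underline{x}\in\mathbb{R}^n$, $s\in\mathbb{N}^n$. Let $\sum\mathbb{R}[\underline{X}]^{2d}$ denote the set of all finite sums of $2d$-th powers of elements of $\mathbb{R}[\underline{X}]$, and for $K\subseteq\mathbb{R}^n$ let $\operatorname{Pos}(K)$ denote the set of all $f\in\mathbb{R}[\underline{X}]$ with $f(\underline{x})\ge 0$ for all $\underline{x}\in K$. A function $\phi:\mathbb{N}^n\to\mathbb{R}_{\ge 0}$ is called an absolute value if $\phi(0)\ge 1$ and $\phi(s+t)\le\phi(s)\phi(t)$ for all $s,t\in\mathbb{N}^n$. For such $\phi$, define the $\phi$-seminorm of $f=\sum_s f_s\underline{X}^s\in\mathbb{R}[\underline{X}]$ by $\|f\|_\phi=\sum_s|f_s|\,\phi(s)$, and put $\mathcal{K}_\phi=\{\underline{x}\in\mathbb{R}^n : |\underline{x}^s|\le\phi(s)\text{ for all } s\in\mathbb{N}^n\}$.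 Then, for every absolute value $\phi$ on $\mathbb{N}^n$, the closure of $\sum\mathbb{R}[\underline{X}]^{2d}$ in $\mathbb{R}[\underline{X}]$, in the topology induced by the seminorm $\|\cdot\|_\phi$, equals $\operatorname{Pos}(\mathcal{K}_\phi)$. In particular, for the constant function $\phi\equiv 1$, the seminorm $\|\cdot\|_\phi$ is the $\ell_1$-norm $\|f\|_1=\sum_s|f_s|$, and the closure of $\sum\mathbb{R}[\underline{X}]^{2d}$ in the topology induced by the $\ell_1$-norm equals $\operatorname{Pos}([-1,1]^n)$. -/

import Mathlib

open scoped NNReal Topology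

noncomputable section

/-- An absolute value on the additive semigroup `ℕⁿ`, with values in the nonnegative reals. -/
structure IsAbsValue {n : ℕ} (φ : (Fin n →₀ ℕ) → ℝ≥0) : Prop where
  one_le : 1 ≤ φ 0
  map_add_le : ∀ s t, φ (s + t) ≤ φ s * φ t

/-- The sum `∑ |f_s| φ(s)` may be taken over any finite set containing the support of `f`. -/
theorem sum_support_eq_of_subset {n : ℕ} (φ : (Fin n →₀ ℕ) → ℝ≥0)
    (f : MvPolynomial (Fin n) ℝ) (T : Finset (Fin n →₀ ℕ)) (hT : f.support ⊆ T) :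
    ∑ s ∈ f.support, |f.coeff s| * (φ s : ℝ) = ∑ s ∈ T, |f.coeff s| * (φ s : ℝ) := by
  refine Finset.sum_subset hT fun s _ hs => ?_
  rw [MvPolynomial.notMem_support_iff.mp hs, abs_zero, zero_mul]

/-- The `φ`-seminorm `‖f‖_φ = ∑ |f_s| φ(s)` on `ℝ[X₁, …, Xₙ]`. -/
def phiSeminorm {n : ℕ} (φ : (Fin n →₀ ℕ) → ℝ≥0) : Seminorm ℝ (MvPolynomial (Fin n) ℝ) :=
  Seminorm.of (fun f => ∑ s ∈ f.support, |f.coeff s| * (φ s : ℝ))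
    (by
      intro f g
      classical
      rw [sum_support_eq_of_subset φ (f + g) (f.support ∪ g.support) MvPolynomial.support_add,
        sum_support_eq_of_subset φ f (f.support ∪ g.support) Finset.subset_union_left,
        sum_support_eq_of_subset φ g (f.support ∪ g.support) Finset.subset_union_right,
        ← Finset.sum_add_distrib]
      refine Finset.sum_le_sum fun s _ => ?_
      rw [MvPolynomial.coeff_add, ← add_mul]
      exact mul_le_mul_of_nonneg_right (abs_add_le _ _) (φ s).coe_nonneg)
    (by
      intro r f
      rw [sum_support_eq_of_subset φ (r • f) f.support MvPolynomial.support_smul,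
        Finset.mul_sum]
      refine Finset.sum_congr rfl fun s _ => ?_
      rw [MvPolynomial.coeff_smul, smul_eq_mul, abs_mul, Real.norm_eq_abs, mul_assoc])

/-- The topology on `ℝ[X₁, …, Xₙ]` induced by the `φ`-seminorm
(the topology of the pseudometric `‖f - g‖_φ`). -/
@[reducible] def phiTopology {n : ℕ} (φ : (Fin n →₀ ℕ) → ℝ≥0) :
    TopologicalSpace (MvPolynomial (Fin n) ℝ) :=
  (phiSeminorm φ).toAddGroupSeminorm.toSeminormedAddCommGroup.toPseudoMetricSpace.toUniformSpace.toTopologicalSpace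

/-- The set of all finite sums of `k`-th powers of elements of `A`. -/
def sumsOfPowers (A : Type*) [CommSemiring A] (k : ℕ) : Set A :=
  {a | ∃ (m : ℕ) (p : Fin m → A), a = ∑ i, p i ^ k}

/-- `K_φ`, the set of real points `x` with `|x^s| ≤ φ(s)` for all `s ∈ ℕⁿ`. -/
def phiSet {n : ℕ} (φ : (Fin n →₀ ℕ) → ℝ≥0) : Set (Fin n → ℝ) :=
  {x | ∀ s : Fin n →₀ ℕ, |∏ i, x i ^ s i| ≤ φ s}

/-- `Pos(K)`, the set of polynomials that are nonnegative on `K ⊆ ℝⁿ`. -/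
def posPolys {n : ℕ} (K : Set (Fin n → ℝ)) : Set (MvPolynomial (Fin n) ℝ) :=
  {f | ∀ x ∈ K, 0 ≤ MvPolynomial.eval x f}

end

/-!
Let `M` be the closure of the sums of `2d`-th powers in a seminormed commutative real algebra `R`.
Multiplication is continuous, so `M` is again a subsemiring, and it is a closed convex cone.

`M` is Archimedean. In the Banach algebra completing `R`, the map `x ↦ x ^ (2d)` is a local
homeomorphism at `1`, because its derivative there is multiplication by `2d`. Every element near
`1` is therefore a limit of `2d`-th powers of elements of `R`
(`eventually_one_add_mem_closure_sumsOfPowers`), and rescaling gives a constant `C` such that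
`t - a ∈ M` whenever `C * ‖a‖ < t`.

If `f ∉ M`, the Hahn–Banach theorem gives a state of `M`, a linear functional nonnegative on `M`
with value `1` at `1`, that is negative at `f`. The states form a compact convex set, so by
Krein–Milman the minimum of the value at `f` is attained at an extreme state. Extreme states are
multiplicative (`map_mul_of_mem_extremePoints_stateSet`), which yields a character `χ` of `R`,
nonnegative on `M`, with `χ f < 0`. The Archimedean bound gives `|χ b| ≤ C * ‖b‖`, and applying
this to powers of `b` gives `|χ b| ≤ ‖b‖`. Hence `M` is the set of elements that are nonnegative
at all contractive characters (`closure_sumsOfPowers_eq`).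

For an absolute value `φ` the seminorm `‖·‖_φ` is submultiplicative, the characters of
`ℝ[X₁, …, Xₙ]` are the evaluations at points of `ℝⁿ`, and the contractive ones are the evaluations
at points of `K_φ` (`mem_phiSet_iff`). For `φ = 1` the set `K_φ` is the cube.
-/

/-! ### Characters of Archimedean semirings -/

/-- The states of a subsemiring `M` of a real algebra `R`: the linear functionals that are
nonnegative on `M` and take the value `1` at `1`. They are encoded as plain functions, so that
the topology of pointwise convergence is the product topology of `R → ℝ`. -/
def stateSet {R : Type*} [CommRing R] [Algebra ℝ R] (M : Subsemiring R) : Set (R → ℝ) :=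
  {L | (∀ x y, L (x + y) = L x + L y) ∧ (∀ (c : ℝ) x, L (c • x) = c * L x) ∧
    (∀ m ∈ M, 0 ≤ L m) ∧ L 1 = 1}

section States

variable {R : Type*} [CommRing R] [Algebra ℝ R] {M : Subsemiring R}

theorem apply_algebraMap_of_mem_stateSet {L : R → ℝ} (hL : L ∈ stateSet M) (r : ℝ) :
    L (algebraMap ℝ R r) = r := by
  rw [Algebra.algebraMap_eq_smul_one, hL.2.1, hL.2.2.2, mul_one]

theorem apply_neg_of_mem_stateSet {L : R → ℝ} (hL : L ∈ stateSet M) (a : R) :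
    L (-a) = -L a := by
  rw [← neg_one_smul ℝ a, hL.2.1, neg_one_mul]

theorem apply_le_of_mem_stateSet {L : R → ℝ} (hL : L ∈ stateSet M) {a : R} {r : ℝ}
    (h : algebraMap ℝ R r - a ∈ M) : L a ≤ r := by
  have := hL.2.2.1 _ h
  rw [sub_eq_add_neg, hL.1, apply_algebraMap_of_mem_stateSet hL,
    apply_neg_of_mem_stateSet hL] at this
  linarith

theorem isClosed_stateSet (M : Subsemiring R) : IsClosed (stateSet M) := by
  simp only [stateSet, Set.ofPred_and, Set.ofPred_forall]
  refine IsClosed.inter ?_ (IsClosed.inter ?_ (IsClosed.inter ?_ ?_))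
  · exact isClosed_iInter fun x => isClosed_iInter fun y =>
      isClosed_eq (continuous_apply _) ((continuous_apply x).add (continuous_apply y))
  · exact isClosed_iInter fun c => isClosed_iInter fun x =>
      isClosed_eq (continuous_apply _) (continuous_const.mul (continuous_apply _))
  · exact isClosed_iInter fun m => isClosed_iInter fun _ =>
      isClosed_le continuous_const (continuous_apply _)
  · exact isClosed_eq (continuous_apply _) continuous_const

/-- The Archimedean property confines each coordinate `L a` of a state to a bounded interval that
does not depend on `L`. -/
theorem isCompact_stateSet (hM : ∀ a : R, ∃ r : ℝ, algebraMap ℝ R r - a ∈ M) :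
    IsCompact (stateSet M) := by
  choose r hr using hM
  refine (isCompact_univ_pi fun a : R => isCompact_Icc (a := -r (-a)) (b := r a)).of_isClosed_subset
    (isClosed_stateSet M) fun L hL a _ => ⟨?_, apply_le_of_mem_stateSet hL (hr a)⟩
  have := apply_le_of_mem_stateSet hL (hr (-a))
  rw [apply_neg_of_mem_stateSet hL] at this
  linarith

/-- For a state `L` and `u ∈ M` with `L u > 0`, the functional `b ↦ L (u * b) / L u` is a state,
because `M` is closed under multiplication. -/
theorem mul_div_mem_stateSet {L : R → ℝ} (hL : L ∈ stateSet M) {u : R} (hu : u ∈ M)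
    (hu0 : 0 < L u) : (fun b => L (u * b) / L u) ∈ stateSet M := by
  refine ⟨fun x y => ?_, fun c x => ?_, fun m hm => ?_, ?_⟩
  · simp only [mul_add, hL.1, add_div]
  · simp only [mul_smul_comm, hL.2.1, mul_div_assoc]
  · exact div_nonneg (hL.2.2.1 _ (M.mul_mem hu hm)) hu0.le
  · simp [hu0.ne']

/-- Extreme states are multiplicative. Given `a`, the Archimedean property provides `u, v ∈ M`
with `u - a` and `u + v` scalars and `L u, L v > 0`; then `L` is a convex combination of the states
`b ↦ L (u * b) / L u` and `b ↦ L (v * b) / L v`, hence equal to the first one. -/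
theorem map_mul_of_mem_extremePoints_stateSet (hone : ∀ r : ℝ, 0 ≤ r → algebraMap ℝ R r ∈ M)
    (hM : ∀ a : R, ∃ r : ℝ, algebraMap ℝ R r - a ∈ M) {L : R → ℝ}
    (hL : L ∈ (stateSet M).extremePoints ℝ) (a b : R) : L (a * b) = L a * L b := by
  have hS := hL.1
  obtain ⟨r₁, h₁⟩ := hM a
  obtain ⟨r₂, h₂⟩ := hM (-a)
  set r : ℝ := max r₁ r₂ + 1 with hr
  have hv : algebraMap ℝ R r - a ∈ M := by
    have : algebraMap ℝ R r - a = (algebraMap ℝ R r₁ - a) + algebraMap ℝ R (r - r₁) := by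
      rw [map_sub]; ring
    rw [this]
    exact M.add_mem h₁ (hone _ (by linarith [le_max_left r₁ r₂]))
  have hu : algebraMap ℝ R r + a ∈ M := by
    have : algebraMap ℝ R r + a = (algebraMap ℝ R r₂ - -a) + algebraMap ℝ R (r - r₂) := by
      rw [map_sub]; ring
    rw [this]
    exact M.add_mem h₂ (hone _ (by linarith [le_max_right r₁ r₂]))
  have hLa : L a ≤ r₁ := apply_le_of_mem_stateSet hS h₁
  have hLa' : -L a ≤ r₂ := by
    rw [← apply_neg_of_mem_stateSet hS]; exact apply_le_of_mem_stateSet hS h₂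
  have hLu : L (algebraMap ℝ R r + a) = r + L a := by
    rw [hS.1, apply_algebraMap_of_mem_stateSet hS]
  have hLv : L (algebraMap ℝ R r - a) = r - L a := by
    rw [sub_eq_add_neg, hS.1, apply_algebraMap_of_mem_stateSet hS,
      apply_neg_of_mem_stateSet hS]; ring
  have hu0 : 0 < L (algebraMap ℝ R r + a) := by
    rw [hLu]; linarith [le_max_right r₁ r₂]
  have hv0 : 0 < L (algebraMap ℝ R r - a) := by
    rw [hLv]; linarith [le_max_left r₁ r₂]
  have hr0 : 0 < r := by linarith
  have key := hL.2 (mul_div_mem_stateSet hS hu hu0) (mul_div_mem_stateSet hS hv hv0)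
    ⟨L (algebraMap ℝ R r + a) / (2 * r), L (algebraMap ℝ R r - a) / (2 * r), by positivity,
      by positivity, by rw [hLu, hLv]; field_simp; ring, by
        funext c
        have h2 : L ((algebraMap ℝ R r + a) * c) + L ((algebraMap ℝ R r - a) * c)
            = 2 * r * L c := by
          rw [← hS.1, ← hS.2.1, Algebra.smul_def, map_mul, map_ofNat]
          congr 1; ring
        simp only [Pi.add_apply, Pi.smul_apply, smul_eq_mul]
        field_simp
        linarith⟩
  have hb : L ((algebraMap ℝ R r + a) * b) / L (algebraMap ℝ R r + a) = L b := congrFun key b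
  rw [div_eq_iff hu0.ne', add_mul, hS.1, hLu, ← Algebra.smul_def, hS.2.1] at hb
  linarith

/-- A form of the Kadison–Dubois representation theorem: an element at which some state of an
Archimedean semiring `M` is negative is also negative at a character that is nonnegative on `M`.
The face of the compact state space on which evaluation at `f` is minimal has an extreme point. -/
theorem exists_algHom_neg_of_state_neg (hone : ∀ r : ℝ, 0 ≤ r → algebraMap ℝ R r ∈ M)
    (hM : ∀ a : R, ∃ r : ℝ, algebraMap ℝ R r - a ∈ M) {f : R} {L₀ : R → ℝ}
    (hL₀ : L₀ ∈ stateSet M) (hf : L₀ f < 0) :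
    ∃ χ : R →ₐ[ℝ] ℝ, (∀ m ∈ M, 0 ≤ χ m) ∧ χ f < 0 := by
  have hc := isCompact_stateSet hM
  let l : StrongDual ℝ (R → ℝ) := -ContinuousLinearMap.proj f
  have hexp : IsExposed ℝ (stateSet M) (l.toExposed (stateSet M)) :=
    ContinuousLinearMap.toExposed.isExposed
  obtain ⟨L₁, hL₁, hmax⟩ := hc.exists_isMaxOn ⟨L₀, hL₀⟩ l.continuous.continuousOn
  obtain ⟨L, hL⟩ := (hexp.isCompact hc).extremePoints_nonempty ⟨L₁, hL₁, fun y hy => hmax hy⟩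
  have hLe := hexp.isExtreme.extremePoints_subset_extremePoints hL
  have hLf : L f < 0 := by
    have : -L₀ f ≤ -L f := hL.1.2 L₀ hL₀
    linarith
  exact ⟨AlgHom.ofLinearMap ⟨⟨L, hLe.1.1⟩, hLe.1.2.1⟩ hLe.1.2.2.2
    (map_mul_of_mem_extremePoints_stateSet hone hM hLe), hLe.1.2.2.1, hLf⟩

end States

/-! ### Sums of powers in seminormed algebras -/

theorem zero_mem_sumsOfPowers (A : Type*) [CommSemiring A] (k : ℕ) : 0 ∈ sumsOfPowers A k :=
  ⟨0, Fin.elim0, by simp⟩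

theorem pow_mem_sumsOfPowers {A : Type*} [CommSemiring A] (k : ℕ) (a : A) :
    a ^ k ∈ sumsOfPowers A k :=
  ⟨1, fun _ => a, by simp⟩

theorem add_mem_sumsOfPowers {A : Type*} [CommSemiring A] {k : ℕ} {a b : A}
    (ha : a ∈ sumsOfPowers A k) (hb : b ∈ sumsOfPowers A k) : a + b ∈ sumsOfPowers A k := by
  obtain ⟨m, p, rfl⟩ := ha
  obtain ⟨l, q, rfl⟩ := hb
  exact ⟨m + l, Fin.append p q, by simp [Fin.sum_univ_add]⟩

theorem sum_mem_sumsOfPowers {A ι : Type*} [CommSemiring A] {k : ℕ} (s : Finset ι) {f : ι → A}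
    (h : ∀ i ∈ s, f i ∈ sumsOfPowers A k) : ∑ i ∈ s, f i ∈ sumsOfPowers A k :=
  Finset.sum_induction f (· ∈ sumsOfPowers A k) (fun _ _ => add_mem_sumsOfPowers)
    (zero_mem_sumsOfPowers A k) h

/-- The sums of `k`-th powers in a commutative semiring, as a subsemiring. -/
def powerSumSubsemiring (A : Type*) [CommSemiring A] (k : ℕ) : Subsemiring A where
  carrier := sumsOfPowers A k
  zero_mem' := zero_mem_sumsOfPowers A k
  one_mem' := by simpa using pow_mem_sumsOfPowers k (1 : A)
  add_mem' := add_mem_sumsOfPowers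
  mul_mem' := by
    rintro _ _ ⟨m, p, rfl⟩ ⟨l, q, rfl⟩
    rw [Finset.sum_mul_sum]
    refine sum_mem_sumsOfPowers _ fun i _ => sum_mem_sumsOfPowers _ fun j _ => ?_
    rw [← mul_pow]
    exact pow_mem_sumsOfPowers _ _

open UniformSpace in
/-- Small perturbations of `1` are limits of `k`-th powers: in the completion, `x ↦ x ^ k` is
invertible near `1` by the inverse function theorem, and roots there are limits of elements
of `R`. -/
theorem eventually_one_add_mem_closure_sumsOfPowers {R : Type*} [SeminormedCommRing R]
    [NormedAlgebra ℝ R] {k : ℕ} (hk : k ≠ 0) :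
    ∀ᶠ a in 𝓝 (0 : R), 1 + a ∈ closure (sumsOfPowers R k) := by
  have hk' : (k : ℝ) ≠ 0 := Nat.cast_ne_zero.mpr hk
  let e : Completion R ≃L[ℝ] Completion R :=
    ContinuousLinearEquiv.smulLeft (Units.mk0 (k : ℝ) hk')
  have hd : HasStrictFDerivAt (fun x : Completion R => x ^ k)
      (e : Completion R →L[ℝ] Completion R) 1 := by
    refine (hasStrictFDerivAt_pow (𝕜 := ℝ) k (x := (1 : Completion R))).congr_fderiv ?_
    ext x
    simp [e, Units.smul_def, Nat.cast_smul_eq_nsmul]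
  have hmap := hd.map_nhds_eq_of_equiv
  have hroot : ∀ᶠ y in 𝓝 (1 : Completion R), ∃ x, x ^ k = y := by
    have : Set.range (fun x : Completion R => x ^ k) ∈
        Filter.map (fun x : Completion R => x ^ k) (𝓝 1) :=
      Filter.mem_map.mpr (Filter.univ_mem' fun x => ⟨x, rfl⟩)
    rw [hmap, one_pow] at this
    exact this
  have hcont : Filter.Tendsto (fun a : R => ((1 + a : R) : Completion R)) (𝓝 0) (𝓝 1) := by
    have : Continuous fun a : R => ((1 + a : R) : Completion R) :=
      (Completion.continuous_coe R).comp (continuous_const.add continuous_id)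
    simpa [Completion.coe_one] using this.tendsto 0
  filter_upwards [hcont.eventually hroot] with a ⟨x, hx⟩
  rw [(Completion.isUniformInducing_coe R).isInducing.closure_eq_preimage_closure_image,
    Set.mem_preimage, ← hx]
  refine map_mem_closure (t := (↑) '' sumsOfPowers R k) (f := fun x : Completion R => x ^ k)
    (continuous_pow k) (Completion.denseRange_coe x) ?_
  rintro _ ⟨p, rfl⟩
  exact ⟨p ^ k, pow_mem_sumsOfPowers k p, map_pow Completion.coeRingHom p k⟩

/-- A character that is bounded with respect to the seminorm is bounded by the seminorm itself,
as is seen by applying the bound to high powers. -/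
theorem abs_algHom_apply_le_norm {R : Type*} [SeminormedCommRing R] [NormedAlgebra ℝ R]
    (χ : R →ₐ[ℝ] ℝ) {C : ℝ} (hC : ∀ b, |χ b| ≤ C * ‖b‖) (b : R) : |χ b| ≤ ‖b‖ := by
  by_contra! h
  have hpos : 0 < |χ b| := (norm_nonneg b).trans_lt h
  have hbound : ∀ m : ℕ, 1 ≤ C * (‖b‖ / |χ b|) ^ (m + 1) := fun m => by
    have h1 := hC (b ^ (m + 1))
    rw [map_pow, abs_pow] at h1
    have hC0 : 0 ≤ C := by
      by_contra! hC0
      nlinarith [hC b, norm_nonneg b]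
    rw [div_pow, mul_div_assoc', le_div_iff₀ (by positivity), one_mul]
    exact h1.trans (mul_le_mul_of_nonneg_left (norm_pow_le' b m.succ_pos) hC0)
  have hlim : Filter.Tendsto (fun m : ℕ => C * (‖b‖ / |χ b|) ^ (m + 1)) Filter.atTop (𝓝 (C * 0)) :=
    ((tendsto_pow_atTop_nhds_zero_of_lt_one (by positivity)
      ((div_lt_one hpos).mpr h)).comp (Filter.tendsto_add_atTop_nat 1)).const_mul C
  have := ge_of_tendsto' hlim hbound
  norm_num at this

/-- In a seminormed commutative real algebra, the closure of the sums of `k`-th powers, `k` even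
and positive, consists of the elements that are nonnegative at all contractive characters. -/
theorem closure_sumsOfPowers_eq {R : Type*} [SeminormedCommRing R] [NormedAlgebra ℝ R] {k : ℕ}
    (hk : k ≠ 0) (hev : Even k) :
    closure (sumsOfPowers R k) =
      {a | ∀ χ : R →ₐ[ℝ] ℝ, (∀ b, |χ b| ≤ ‖b‖) → 0 ≤ χ a} := by
  apply Set.Subset.antisymm
  · intro a ha χ hχ
    have hcont : Continuous χ :=
      AddMonoidHomClass.continuous_of_bound χ 1 fun b => by simpa using hχ b
    refine closure_minimal (t := {a | 0 ≤ χ a}) ?_ (isClosed_le continuous_const hcont) ha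
    rintro _ ⟨m, p, rfl⟩
    simp only [Set.mem_ofPred_eq, map_sum, map_pow]
    exact Finset.sum_nonneg fun i _ => hev.pow_nonneg _
  · intro f hf
    by_contra hfM
    let M : Subsemiring R := (powerSumSubsemiring R k).topologicalClosure
    have hMc : (M : Set R) = closure (sumsOfPowers R k) := rfl
    have hone : ∀ r : ℝ, 0 ≤ r → algebraMap ℝ R r ∈ M := fun r hr => by
      refine (powerSumSubsemiring R k).le_topologicalClosure ?_
      obtain ⟨s, rfl⟩ : ∃ s : ℝ, s ^ k = r :=
        ⟨r ^ ((k : ℝ)⁻¹), Real.rpow_inv_natCast_pow hr hk⟩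
      rw [map_pow]
      exact pow_mem_sumsOfPowers k _
    have hsmul : ∀ r : ℝ, 0 ≤ r → ∀ m ∈ M, r • m ∈ M := fun r hr m hm => by
      rw [Algebra.smul_def]
      exact M.mul_mem (hone r hr) hm
    obtain ⟨δ, hδ, hball⟩ := Metric.eventually_nhds_iff.mp
      (eventually_one_add_mem_closure_sumsOfPowers (R := R) hk)
    -- Rescaling turns membership near `1` into a bound that is linear in the norm; the
    -- parameter `t` replaces `‖a‖`, which may vanish.
    have hlin : ∀ (a : R) (t : ℝ), ‖a‖ < t → algebraMap ℝ R (δ⁻¹ * t) - a ∈ M := fun a t ht => by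
      have ht0 : 0 < t := (norm_nonneg a).trans_lt ht
      have h1 : 1 + (-(δ / t)) • a ∈ M := hball (by
        rw [dist_zero_right, norm_smul, norm_neg, Real.norm_of_nonneg (by positivity),
          div_mul_eq_mul_div, div_lt_iff₀ ht0]
        exact mul_lt_mul_of_pos_left ht hδ)
      have h2 := hsmul (δ⁻¹ * t) (by positivity) _ h1
      have hc : δ⁻¹ * t * -(δ / t) = -1 := by field_simp
      rwa [smul_add, smul_smul, hc, neg_one_smul, ← sub_eq_add_neg,
        ← Algebra.algebraMap_eq_smul_one] at h2
    have hM : ∀ a : R, ∃ r : ℝ, algebraMap ℝ R r - a ∈ M := fun a =>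
      ⟨_, hlin a (‖a‖ + 1) (lt_add_one _)⟩
    have hconv : Convex ℝ (M : Set R) := fun x hx y hy s t hs ht _ =>
      M.add_mem (hsmul s hs x hx) (hsmul t ht y hy)
    obtain ⟨g, u, hgf, hgM⟩ := geometric_hahn_banach_point_closed hconv
      (hMc ▸ isClosed_closure) (show f ∉ (M : Set R) from hfM)
    have hu : u < 0 := by simpa using hgM 0 M.zero_mem
    -- A linear functional that is bounded below on a cone is nonnegative there.
    have hg0 : ∀ m ∈ M, 0 ≤ g m := fun m hm => by
      by_contra! hneg
      have := hgM _ (hsmul (u / g m) (div_nonneg_of_nonpos hu.le hneg.le) m hm)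
      rw [map_smul, smul_eq_mul, div_mul_cancel₀ _ hneg.ne] at this
      exact lt_irrefl _ this
    have hg1 : 0 < g 1 := by
      refine (hg0 1 M.one_mem).lt_of_ne fun h0 => ?_
      obtain ⟨r, hr⟩ := hM (-f)
      have := hg0 _ hr
      rw [Algebra.algebraMap_eq_smul_one, map_sub, map_smul, ← h0, map_neg] at this
      simp only [smul_zero, zero_sub, neg_neg] at this
      linarith
    obtain ⟨χ, hχM, hχf⟩ := exists_algHom_neg_of_state_neg (M := M) hone hM (f := f)
      (L₀ := fun a => g a / g 1)
      ⟨fun x y => by simp only [map_add, add_div],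
        fun c x => by simp only [map_smul, smul_eq_mul, mul_div_assoc],
        fun m hm => div_nonneg (hg0 m hm) hg1.le, div_self hg1.ne'⟩
      (div_neg_of_neg_of_pos (hgf.trans hu) hg1)
    have hle : ∀ b, χ b ≤ δ⁻¹ * ‖b‖ := fun b => by
      have hlt : ∀ t, ‖b‖ < t → χ b ≤ δ⁻¹ * t := fun t ht => by
        have := hχM _ (hlin b t ht)
        rw [map_sub, AlgHom.commutes] at this
        exact sub_nonneg.mp this
      have hlim : Filter.Tendsto (fun t : ℝ => δ⁻¹ * t) (𝓝[>] ‖b‖) (𝓝 (δ⁻¹ * ‖b‖)) :=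
        ((continuous_const.mul continuous_id).tendsto _).mono_left nhdsWithin_le_nhds
      exact ge_of_tendsto hlim (Filter.eventually_of_mem self_mem_nhdsWithin hlt)
    have habs : ∀ b, |χ b| ≤ δ⁻¹ * ‖b‖ := fun b => abs_le'.mpr
      ⟨hle b, by simpa using hle (-b)⟩
    exact hχf.not_ge (hf χ (abs_algHom_apply_le_norm χ habs))

/-! ### The weighted seminorm on polynomials -/

section Polynomials

variable {n : ℕ} {φ : (Fin n →₀ ℕ) → ℝ≥0}

theorem phiSeminorm_apply (φ : (Fin n →₀ ℕ) → ℝ≥0) (f : MvPolynomial (Fin n) ℝ) :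
    phiSeminorm φ f = ∑ s ∈ f.support, |f.coeff s| * (φ s : ℝ) := rfl

theorem phiSeminorm_monomial (φ : (Fin n →₀ ℕ) → ℝ≥0) (s : Fin n →₀ ℕ) (c : ℝ) :
    phiSeminorm φ (MvPolynomial.monomial s c) = |c| * φ s := by
  rw [phiSeminorm_apply, sum_support_eq_of_subset φ _ {s} MvPolynomial.support_monomial_subset]
  simp

theorem IsAbsValue.phiSeminorm_mul_le (hφ : IsAbsValue φ) (f g : MvPolynomial (Fin n) ℝ) :
    phiSeminorm φ (f * g) ≤ phiSeminorm φ f * phiSeminorm φ g := by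
  conv_lhs => rw [MvPolynomial.as_sum f, MvPolynomial.as_sum g, Finset.sum_mul_sum]
  rw [phiSeminorm_apply φ f, phiSeminorm_apply φ g, Finset.sum_mul_sum]
  refine (Finset.le_sum_of_subadditive _ (map_zero _).le (map_add_le_add _) _ _).trans (Finset.sum_le_sum fun s _ => ?_)
  refine (Finset.le_sum_of_subadditive _ (map_zero _).le (map_add_le_add _) _ _).trans (Finset.sum_le_sum fun t _ => ?_)
  rw [MvPolynomial.monomial_mul, phiSeminorm_monomial, abs_mul, mul_mul_mul_comm]
  exact mul_le_mul_of_nonneg_left (mod_cast hφ.map_add_le s t) (by positivity)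

/-- The polynomial ring with the `φ`-seminorm, as a seminormed ring whose topology is
`phiTopology φ` by definition. -/
@[reducible] noncomputable def IsAbsValue.seminormedCommRing (hφ : IsAbsValue φ) :
    SeminormedCommRing (MvPolynomial (Fin n) ℝ) where
  __ := (inferInstance : CommRing (MvPolynomial (Fin n) ℝ))
  __ := (phiSeminorm φ).toAddGroupSeminorm.toSeminormedAddCommGroup
  norm_mul_le := hφ.phiSeminorm_mul_le

theorem abs_eval_le_phiSeminorm {x : Fin n → ℝ} (hx : x ∈ phiSet φ)
    (f : MvPolynomial (Fin n) ℝ) : |MvPolynomial.eval x f| ≤ phiSeminorm φ f := by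
  rw [MvPolynomial.eval_eq', phiSeminorm_apply]
  refine (Finset.abs_sum_le_sum_abs _ _).trans (Finset.sum_le_sum fun s _ => ?_)
  rw [abs_mul]
  exact mul_le_mul_of_nonneg_left (hx s) (abs_nonneg _)

/-- The points of `K_φ` are exactly the evaluations that are contractive for the
`φ`-seminorm. -/
theorem mem_phiSet_iff {x : Fin n → ℝ} :
    x ∈ phiSet φ ↔ ∀ f, |MvPolynomial.eval x f| ≤ phiSeminorm φ f := by
  refine ⟨abs_eval_le_phiSeminorm, fun h s => ?_⟩
  have := h (MvPolynomial.monomial s 1)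
  rw [phiSeminorm_monomial, MvPolynomial.eval_monomial, Finsupp.prod_fintype _ _ (by simp)] at this
  simpa using this

theorem IsAbsValue.closure_sumsOfPowers (hφ : IsAbsValue φ) {d : ℕ} (hd : 1 ≤ d) :
    closure[phiTopology φ] (sumsOfPowers (MvPolynomial (Fin n) ℝ) (2 * d))
      = posPolys (phiSet φ) := by
  let := hφ.seminormedCommRing
  let : NormedAlgebra ℝ (MvPolynomial (Fin n) ℝ) :=
    { (inferInstance : Algebra ℝ (MvPolynomial (Fin n) ℝ)) with
      norm_smul_le := fun r f => (map_smul_eq_mul (phiSeminorm φ) r f).le }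
  refine (closure_sumsOfPowers_eq (R := MvPolynomial (Fin n) ℝ) (by lia)
    (even_two_mul d)).trans (Set.ext fun f => ⟨fun h x hx => ?_, fun h χ hχ => ?_⟩)
  · have := h (MvPolynomial.aeval x) fun b => by
      rw [MvPolynomial.aeval_eq_eval]
      exact abs_eval_le_phiSeminorm hx b
    rwa [MvPolynomial.aeval_eq_eval] at this
  · have hev : ∀ b, χ b = MvPolynomial.eval (χ ∘ MvPolynomial.X) b := fun b => by
      conv_lhs => rw [MvPolynomial.aeval_unique χ]
      rw [MvPolynomial.aeval_eq_eval]
    rw [hev]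
    exact h _ (mem_phiSet_iff.mpr fun b => by rw [← hev]; exact hχ b)

theorem isAbsValue_one : IsAbsValue (fun _ : Fin n →₀ ℕ => (1 : ℝ≥0)) :=
  ⟨le_rfl, fun _ _ => by simp⟩

theorem phiSet_one :
    phiSet (fun _ : Fin n →₀ ℕ => (1 : ℝ≥0)) = {x | ∀ i, x i ∈ Set.Icc (-1 : ℝ) 1} := by
  ext x
  refine ⟨fun h i => ?_, fun h s => ?_⟩
  · have := h (Finsupp.single i 1)
    rw [Finset.prod_eq_single i (fun j _ hj => by simp [hj.symm]) (by simp)] at this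
    exact abs_le.mp (by simpa using this)
  · rw [Finset.abs_prod]
    refine Finset.prod_le_one (fun i _ => abs_nonneg _) fun i _ => ?_
    rw [abs_pow]
    exact pow_le_one₀ (abs_nonneg _) (abs_le.mpr (h i))

end Polynomials

theorem mainTheorem1 (n d : ℕ) (hd : 1 ≤ d) :
    (∀ φ : (Fin n →₀ ℕ) → ℝ≥0, IsAbsValue φ →
      closure[phiTopology φ] (sumsOfPowers (MvPolynomial (Fin n) ℝ) (2 * d))
        = posPolys (phiSet φ)) ∧
    (∀ f : MvPolynomial (Fin n) ℝ,
      phiSeminorm (fun _ => 1) f = ∑ s ∈ f.support, |f.coeff s|) ∧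
    closure[phiTopology (n := n) (fun _ => 1)]
        (sumsOfPowers (MvPolynomial (Fin n) ℝ) (2 * d))
      = posPolys {x : Fin n → ℝ | ∀ i, x i ∈ Set.Icc (-1 : ℝ) 1} := by
  refine ⟨fun φ hφ => hφ.closure_sumsOfPowers hd, fun f => by simp [phiSeminorm_apply], ?_⟩
  rw [isAbsValue_one.closure_sumsOfPowers hd, phiSet_one]
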